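/- Let $n\ge 1$ and $d\ge 2$ be integers. Identify $\mathrm{Sym}^d(\mathbb{C}^{N})$ with the space of degree-$d$ forms over $\mathbb{C}$ in $N$ variables. The Waring rank $\mathrm{rk}(F)$ of a form $F\in \mathrm{Sym}^d(\mathbb{C}^{N})$ is the least $r$ such that $F=\sum_{i=1}^r L_i^d$ with linear forms $L_i$. For a nonzero form $F\in\mathrm{Sym}^d(\mathbb{C}^{n+1})$ of rank $s$, the Waring locus $\mathcal{W}(F)\subset\mathbb{P}(\mathrm{Sym}^1(\mathbb{C}^{n+1}))$ is the set of points $[L]$ such that $F\in\langle L^d,L_2^d,\dots,L_s^d\rangle$ for some $[L_2],\dots,[L_s]\in\mathbb{P}(\mathrm{Sym}^1(\mathbb{C}^{n+1}))$, and $\mathrm{Eig}(F)$ is the set of points $[L]$, $L=\sum_i a_ix_i$, such that all $2\times 2$ minors of the matrix with rows $\nabla F(a)$ and $a$ vanish. Let $V_n^d=\{[L^d]\}\subset\mathbb{P}(\mathrm{Sym}^d(\mathbb{C}^{n+1}))$ be the Veronese variety and let $\sigma_r^\circ(V_n^d)$ be the union of the linear spans $\langle p_1,\dots,p_r\rangle$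 with $p_1,\dots,p_r\in V_n^d$. For $r\ge 1$ the critical Waring variety is the Zariski closure $$\mathrm{WE}^d_{n,r}=\overline{\{[F]\in\sigma_r^\circ(V_n^d)\mid \mathcal{W}(F)\cap\mathrm{Eig}(F)\neq\emptyset\}}\subset\mathbb{P}(\mathrm{Sym}^d(\mathbb{C}^{n+1})).$$ Then the Waring ranks of the forms in $\mathrm{Sym}^d(\mathbb{C}^n)$ have a maximum $m_{n-1}$, and for every integer $r$ with $1\le r\le \max\left\{\frac{d+1}{2},\,m_{n-1}+1\right\}$ the variety $\mathrm{WE}^d_{n,r}$ contains the class $[F]$ of a form $F$ of Waring rank exactly $r$. -/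

import Mathlib

noncomputable section

namespace Waring

/-- Degree-`d` forms over `ℂ` in the variables `x 0, …, x (N - 1)`, i.e. `Sym^d(ℂ^N)`. -/
abbrev Form (N d : ℕ) : Type :=
  MvPolynomial.homogeneousSubmodule (Fin N) ℂ d

/-- The `d`-th power of a linear form, as a form of degree `d`. -/
def powForm {N : ℕ} (d : ℕ) (L : Form N 1) : Form N d :=
  ⟨(L : MvPolynomial (Fin N) ℂ) ^ d, by
    have h := (MvPolynomial.mem_homogeneousSubmodule 1 _).1 L.2
    simpa using h.pow d⟩

/-- `F` is a sum of `r` powers `L_1^d + ⋯ + L_r^d` of linear forms. -/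
def HasWaringDecomposition {N d : ℕ} (F : Form N d) (r : ℕ) : Prop :=
  ∃ L : Fin r → Form N 1, F = ∑ i, powForm d (L i)

/-- The Waring rank: the least length of a Waring decomposition. -/
def waringRank {N d : ℕ} (F : Form N d) : ℕ :=
  sInf {r : ℕ | HasWaringDecomposition F r}

/-- The supremum of the Waring ranks of the forms in `Sym^d(ℂ^N)`. -/
def maxWaringRank (N d : ℕ) : ℕ :=
  sSup (Set.range fun G : Form N d => waringRank G)

/-- The Veronese variety of powers `[L^d]` in the projective space of forms of degree `d`. -/
def veronese (N d : ℕ) : Set (Projectivization ℂ (Form N d)) :=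
  {p | ∃ (L : Form N 1) (h : powForm d L ≠ 0), p = Projectivization.mk ℂ (powForm d L) h}

/-- The union of the linear spans of `r` points of `X`. -/
def openSecant {V : Type*} [AddCommGroup V] [Module ℂ V] (r : ℕ)
    (X : Set (Projectivization ℂ V)) : Set (Projectivization ℂ V) :=
  {p | ∃ x : Fin r → Projectivization ℂ V,
    (∀ i, x i ∈ X) ∧ p.submodule ≤ ⨆ i, (x i).submodule}

/-- The value at `v` of a polynomial expression `P` in linear functionals on `V`. -/
def evalAt {V : Type*} [AddCommGroup V] [Module ℂ V]
    (P : MvPolynomial (Module.Dual ℂ V) ℂ) (v : V) : ℂ :=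
  MvPolynomial.eval (fun φ : Module.Dual ℂ V => φ v) P

/-- The closure in the Zariski topology of a set `S` of points of `ℙ(V)`: the common zeros of all
homogeneous polynomials on `V` that vanish on `S`. -/
def zariskiClosure {V : Type*} [AddCommGroup V] [Module ℂ V]
    (S : Set (Projectivization ℂ V)) : Set (Projectivization ℂ V) :=
  {p | ∀ (k : ℕ) (P : MvPolynomial (Module.Dual ℂ V) ℂ), P.IsHomogeneous k →
    (∀ (v : V) (hv : v ≠ 0), Projectivization.mk ℂ v hv ∈ S → evalAt P v = 0) →
    ∀ (v : V) (hv : v ≠ 0), Projectivization.mk ℂ v hv = p → evalAt P v = 0}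

/-- The Waring locus: the points `[L]` for which `L` occurs among `r = rk(F)` linear forms the
span of whose `d`-th powers contains `F`. -/
def waringLocus {N d : ℕ} (F : Form N d) : Set (Projectivization ℂ (Form N 1)) :=
  {p | ∃ L : Fin (waringRank F) → Form N 1,
    (∀ i, L i ≠ 0) ∧
    (∃ (i : Fin (waringRank F)) (h : L i ≠ 0), Projectivization.mk ℂ (L i) h = p) ∧
    F ∈ Submodule.span ℂ (Set.range fun i => powForm d (L i))}

/-- The vector of coefficients of a linear form. -/
def coords {N : ℕ} (L : Form N 1) : Fin N → ℂ :=
  fun i => MvPolynomial.coeff (Finsupp.single i 1) (L : MvPolynomial (Fin N) ℂ)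

/-- The value of the gradient of `F` at a point. -/
def gradAt {N d : ℕ} (F : Form N d) (a : Fin N → ℂ) : Fin N → ℂ :=
  fun i => MvPolynomial.eval a (MvPolynomial.pderiv i (F : MvPolynomial (Fin N) ℂ))

/-- The points of the eigenscheme: all `[L]` at whose coefficient vector `a` the `2 × 2` minors of
the matrix with rows `∇F(a)` and `a` vanish. -/
def eigenPoints {N d : ℕ} (F : Form N d) : Set (Projectivization ℂ (Form N 1)) :=
  {p | ∃ (L : Form N 1) (h : L ≠ 0), Projectivization.mk ℂ L h = p ∧
    ∀ i j : Fin N,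
      Matrix.det !![gradAt F (coords L) i, gradAt F (coords L) j; coords L i, coords L j] = 0}

/-- The critical Waring variety of rank-`r` forms of degree `d` in `n + 1` variables. -/
def criticalWaringVariety (n d r : ℕ) : Set (Projectivization ℂ (Form (n + 1) d)) :=
  zariskiClosure {p | p ∈ openSecant r (veronese (n + 1) d) ∧
    ∃ (F : Form (n + 1) d) (hF : F ≠ 0), Projectivization.mk ℂ F hF = p ∧
      (waringLocus F ∩ eigenPoints F).Nonempty}

end Waring

end

open MvPolynomial

/-! Write `r = q + 1`. Each example has the form `x₀ ^ d + L₁ ^ d + ⋯ + L_q ^ d`, has rank `q + 1`,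
and has `∇F(e₀)` proportional to `e₀`. So `[x₀]` is in both the Waring locus and the eigenscheme,
and `[F]` lies in the set before closure. For `q ≤ m_{n-1}`, take `x₀ ^ d + G(x₁, …, xₙ)` with `G`
of rank `q`: the new variable raises the rank by exactly one (`hasWaringDecomposition_of_add_pow`).
Otherwise `2 * (q + 1) ≤ d + 1`, and `L_i = x₀ + ζ ^ i x₁` with `ζ` a primitive `q`-th root of
unity: the sum of the roots vanishes, which makes `e₀` an eigenpoint, and few non-proportional
powers have the expected rank (`waringRank_eq_of_two_mul_le`). -/

namespace Waring

/-! ### Linear forms as coefficient vectors -/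

/-- The linear form with coefficient vector `a`. -/
noncomputable def linForm {N : ℕ} (a : Fin N → ℂ) : Form N 1 :=
  ⟨∑ k, a k • X k, Submodule.sum_mem _ fun k _ => Submodule.smul_mem _ _ (isHomogeneous_X ℂ k)⟩

variable {N d : ℕ}

theorem linForm_surjective : Function.Surjective (linForm (N := N)) := by
  intro L
  obtain ⟨c, hc⟩ := (Submodule.mem_span_range_iff_exists_fun ℂ).1
    ((homogeneousSubmodule_one_eq_span_X (σ := Fin N) (R := ℂ)).le L.2)
  exact ⟨c, Subtype.ext hc⟩

theorem coords_linForm (a : Fin N → ℂ) : coords (linForm a) = a := by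
  funext i
  simp [coords, linForm, coeff_sum, coeff_X, Finsupp.single_left_inj]

theorem eval_linForm (a v : Fin N → ℂ) : eval v (linForm a : MvPolynomial (Fin N) ℂ) = a ⬝ᵥ v := by
  simp [linForm, dotProduct, smul_eval]

theorem linForm_injective : Function.Injective (linForm (N := N)) := fun a b h => by
  rw [← coords_linForm a, h, coords_linForm]

theorem linForm_zero : linForm (0 : Fin N → ℂ) = 0 := Subtype.ext (by simp [linForm])

theorem linForm_ne_zero {a : Fin N → ℂ} (ha : a ≠ 0) : linForm a ≠ 0 := fun h =>
  ha (linForm_injective (h.trans linForm_zero.symm))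

theorem powForm_ne_zero {L : Form N 1} (hL : L ≠ 0) : powForm d L ≠ 0 := fun h =>
  pow_ne_zero d (fun h' => hL (Subtype.ext h')) (congrArg Subtype.val h)

theorem powForm_zero (hd : d ≠ 0) : powForm d (0 : Form N 1) = 0 :=
  Subtype.ext (zero_pow hd)

theorem eval_powForm (a v : Fin N → ℂ) :
    eval v (powForm d (linForm a) : MvPolynomial (Fin N) ℂ) = (a ⬝ᵥ v) ^ d := by
  rw [← eval_linForm, ← map_pow]; rfl

theorem form_ext {F G : Form N d}
    (h : ∀ v, eval v (F : MvPolynomial (Fin N) ℂ) = eval v (G : MvPolynomial (Fin N) ℂ)) :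
    F = G := Subtype.ext (MvPolynomial.funext h)

theorem eval_sum_powForm {ι : Type*} [Fintype ι] (a : ι → Fin N → ℂ) (v : Fin N → ℂ) :
    eval v ((∑ i, powForm d (linForm (a i)) : Form N d) : MvPolynomial (Fin N) ℂ) =
      ∑ i, (a i ⬝ᵥ v) ^ d := by
  simp [eval_powForm]

theorem hasWaringDecomposition_iff {F : Form N d} {r : ℕ} :
    HasWaringDecomposition F r ↔
      ∃ a : Fin r → Fin N → ℂ, F = ∑ i, powForm d (linForm (a i)) := by
  constructor
  · rintro ⟨L, rfl⟩
    choose a ha using fun i => linForm_surjective (L i)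
    exact ⟨a, by simp [ha]⟩
  · rintro ⟨a, rfl⟩
    exact ⟨fun i => linForm (a i), rfl⟩

theorem hasWaringDecomposition_iff_eval {F : Form N d} {r : ℕ} :
    HasWaringDecomposition F r ↔
      ∃ a : Fin r → Fin N → ℂ, ∀ v, eval v (F : MvPolynomial (Fin N) ℂ) = ∑ i, (a i ⬝ᵥ v) ^ d := by
  rw [hasWaringDecomposition_iff]
  refine exists_congr fun a => ⟨?_, fun h => form_ext fun v => ?_⟩
  · rintro rfl v
    exact eval_sum_powForm a v
  · rw [h, eval_sum_powForm]

/-! ### Finiteness of the Waring rank and attained ranks -/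

/-- If a functional `ψ` kills all `d`-th powers, then `ψ((∑ a_k x_k) ^ d)` is a polynomial `Q` in
`a` vanishing everywhere. Its coefficients are nonzero multinomials times the values of `ψ` on
monomials, so `ψ` kills every form. -/
theorem span_powForm (N d : ℕ) :
    Submodule.span ℂ (Set.range (powForm (N := N) d)) = ⊤ := by
  by_contra hne
  obtain ⟨F, hF⟩ : ∃ F, F ∉ Submodule.span ℂ (Set.range (powForm (N := N) d)) := by
    by_contra! h
    exact hne (eq_top_iff.2 fun F _ => h F)
  have hF' : (F : MvPolynomial (Fin N) ℂ) ∉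
      (Submodule.span ℂ (Set.range (powForm (N := N) d))).map (Submodule.subtype _) := by
    rintro ⟨G, hG, hGF⟩
    exact hF (Subtype.ext hGF ▸ hG)
  obtain ⟨ψ, hψF, hψ⟩ := Submodule.exists_le_ker_of_notMem hF'
  have hpow : ∀ a : Fin N → ℂ, ψ ((∑ k, a k • X k) ^ d) = 0 := fun a =>
    hψ ⟨powForm d (linForm a), Submodule.subset_span ⟨_, rfl⟩, rfl⟩
  set Q : MvPolynomial (Fin N) ℂ := ∑ k ∈ Finset.piAntidiag Finset.univ d,
    C ((Nat.multinomial Finset.univ k : ℂ) * ψ (∏ i, X i ^ k i)) * ∏ i, X i ^ k i with hQdef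
  have hQ : Q = 0 := by
    refine MvPolynomial.funext fun a => ?_
    rw [map_zero, ← hpow a, Finset.sum_pow_eq_sum_piAntidiag, map_sum, map_sum]
    refine Finset.sum_congr rfl fun k _ => ?_
    have : ((Nat.multinomial Finset.univ k : ℕ) : MvPolynomial (Fin N) ℂ) *
        ∏ i, (a i • X i : MvPolynomial (Fin N) ℂ) ^ k i =
        ((Nat.multinomial Finset.univ k : ℂ) * ∏ i, a i ^ k i) • ∏ i, X i ^ k i := by
      simp only [smul_eq_C_mul, mul_pow, Finset.prod_mul_distrib, map_mul, map_prod, map_pow,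
        map_natCast]
      ring
    rw [this, map_smul]
    simp only [map_mul, eval_C, map_prod, map_pow, eval_X, smul_eq_mul]
    ring
  have hmon : ∀ s : Fin N →₀ ℕ, s.degree = d → ψ (monomial s 1) = 0 := by
    intro s hs
    have h0 : coeff s Q = 0 := by rw [hQ, coeff_zero]
    have hs' : (s : Fin N → ℕ) ∈ Finset.piAntidiag Finset.univ d := by
      simp [← hs, Finsupp.degree_eq_sum]
    rw [hQdef, coeff_sum, Finset.sum_eq_single_of_mem (s : Fin N → ℕ) hs'] at h0
    · have hp : (∏ i, X i ^ s i : MvPolynomial (Fin N) ℂ) = monomial s 1 := by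
        rw [← prod_X_pow_eq_monomial]
        refine (Finset.prod_subset (Finset.subset_univ _) fun i _ hi => ?_).symm
        rw [Finsupp.notMem_support_iff.1 hi, pow_zero]
      rw [hp, coeff_C_mul, coeff_monomial, if_pos rfl, mul_one] at h0
      refine (mul_eq_zero.1 h0).resolve_left ?_
      exact_mod_cast (Nat.multinomial_pos _ _).ne'
    · intro k _ hk
      rw [coeff_C_mul, coeff_prod_X_pow, if_neg, mul_zero]
      rintro rfl
      exact hk (by ext i; simp [Finsupp.indicator])
  apply hψF
  rw [F.1.as_sum, map_sum]
  refine Finset.sum_eq_zero fun s hs => ?_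
  have hFh : (F : MvPolynomial (Fin N) ℂ).IsHomogeneous d := F.2
  have : monomial s (coeff s F.1) = coeff s F.1 • monomial s 1 := by simp [smul_monomial]
  rw [this, map_smul, hmon s (by
    by_contra hne
    exact mem_support_iff.1 hs (hFh.coeff_eq_zero hne)), smul_zero]

theorem exists_forall_hasWaringDecomposition (N : ℕ) (hd : d ≠ 0) :
    ∃ m, ∀ F : Form N d, HasWaringDecomposition F m := by
  have : Module.Finite ℂ (Form N d) := Module.Finite.iff_fg.2 (homogeneousSubmodule_fg _ _ d)
  obtain ⟨f, hf, hspan, -⟩ :=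
    Submodule.exists_fun_fin_finrank_span_eq ℂ (Set.range (powForm (N := N) d))
  replace hspan := hspan.trans (span_powForm N d)
  choose L hL using hf
  refine ⟨Module.finrank ℂ (Submodule.span ℂ (Set.range (powForm (N := N) d))), fun F => ?_⟩
  obtain ⟨c, rfl⟩ := (Submodule.mem_span_range_iff_exists_fun ℂ).1
    (hspan ▸ Submodule.mem_top : F ∈ Submodule.span ℂ (Set.range f))
  -- Scalars are absorbed into the linear forms by `d`-th roots.
  choose z hz using fun i => IsAlgClosed.exists_pow_nat_eq (c i) (Nat.pos_of_ne_zero hd)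
  refine ⟨fun i => z i • L i, Finset.sum_congr rfl fun i _ => ?_⟩
  rw [← hL i, ← hz i]
  exact Subtype.ext (smul_pow (z i) (L i : MvPolynomial (Fin N) ℂ) d).symm

theorem waringRank_le {F : Form N d} {r : ℕ} (h : HasWaringDecomposition F r) :
    waringRank F ≤ r := Nat.sInf_le h

theorem hasWaringDecomposition_waringRank (hd : d ≠ 0) (F : Form N d) :
    HasWaringDecomposition F (waringRank F) :=
  Nat.sInf_mem (s := {r | HasWaringDecomposition F r})
    ((exists_forall_hasWaringDecomposition N hd).imp fun _ h => h F)

theorem isGreatest_maxWaringRank (N : ℕ) (hd : d ≠ 0) :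
    IsGreatest (Set.range fun G : Form N d => waringRank G) (maxWaringRank N d) := by
  obtain ⟨m, hm⟩ := exists_forall_hasWaringDecomposition (d := d) N hd
  have hb : BddAbove (Set.range fun G : Form N d => waringRank G) :=
    ⟨m, by rintro _ ⟨F, rfl⟩; exact waringRank_le (hm F)⟩
  exact ⟨Nat.sSup_mem (Set.range_nonempty _) hb, fun _ h => le_csSup hb h⟩

/-- Dropping one term of a minimal decomposition lowers the rank by exactly one. -/
theorem exists_waringRank_eq_of_le (hd : d ≠ 0) (F : Form N d) {k : ℕ} (hk : k ≤ waringRank F) :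
    ∃ G : Form N d, waringRank G = k := by
  induction hk using Nat.decreasingInduction with
  | self => exact ⟨F, rfl⟩
  | of_succ k _ ih =>
    obtain ⟨G, hG⟩ := ih
    obtain ⟨L, hL⟩ := hG ▸ hasWaringDecomposition_waringRank hd G
    rw [Fin.sum_univ_succ] at hL
    refine ⟨∑ i : Fin k, powForm d (L i.succ), le_antisymm (waringRank_le ⟨_, rfl⟩) ?_⟩
    obtain ⟨M, hM⟩ :=
      hasWaringDecomposition_waringRank hd (∑ i : Fin k, powForm d (L i.succ))
    rw [hM] at hL
    have : waringRank G ≤ waringRank (∑ i : Fin k, powForm d (L i.succ)) + 1 :=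
      waringRank_le ⟨Fin.cons (L 0) M, by simpa [Fin.sum_univ_succ] using hL⟩
    omega

/-! ### Adding a power of a new variable -/

/-- Removing a power of a separate variable lowers the Waring rank. -/
theorem hasWaringDecomposition_of_add_pow (hd : 2 ≤ d) {F : Form (N + 1) d} {G : Form N d}
    (h : ∀ t w, eval (Fin.cons t w : Fin (N + 1) → ℂ) (F : MvPolynomial (Fin (N + 1)) ℂ) =
      t ^ d + eval w (G : MvPolynomial (Fin N) ℂ)) {s : ℕ}
    (hF : HasWaringDecomposition F (s + 1)) : HasWaringDecomposition G s := by
  obtain ⟨a, ha⟩ := hasWaringDecomposition_iff_eval.1 hF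
  -- As `d ≥ 2`, there are at least two `d`-th roots of unity to choose from.
  obtain ⟨z, hz, hza⟩ : ∃ z : ℂ, z ^ d = 1 ∧ z ≠ a 0 0 := by
    have hd0 : d ≠ 0 := by omega
    have hζ := Complex.isPrimitiveRoot_exp d hd0
    by_cases h1 : (1 : ℂ) = a 0 0
    · exact ⟨_, hζ.pow_eq_one, fun h => hζ.ne_one (by omega) (h.trans h1.symm)⟩
    · exact ⟨1, one_pow d, h1⟩
  have hz' : z - a 0 0 ≠ 0 := sub_ne_zero.2 hza
  refine hasWaringDecomposition_iff_eval.2 ⟨fun i =>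
    (a i.succ 0 * (z - a 0 0)⁻¹) • Fin.tail (a 0) + Fin.tail (a i.succ), fun w => ?_⟩
  -- Restrict to the hyperplane where the first linear form equals `z * t`; there its power is `t ^
  -- d` and cancels against the separate variable.
  have key := ha (Fin.cons ((z - a 0 0)⁻¹ * (Fin.tail (a 0) ⬝ᵥ w)) w)
  have hdot : ∀ (b : Fin (N + 1) → ℂ) (t : ℂ),
      b ⬝ᵥ (Fin.cons t w : Fin (N + 1) → ℂ) = b 0 * t + Fin.tail b ⬝ᵥ w := fun b t => by
    simp [dotProduct, Fin.sum_univ_succ, Fin.tail]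
  rw [h, Fin.sum_univ_succ, hdot] at key
  have h0 : a 0 0 * ((z - a 0 0)⁻¹ * (Fin.tail (a 0) ⬝ᵥ w)) + Fin.tail (a 0) ⬝ᵥ w =
      z * ((z - a 0 0)⁻¹ * (Fin.tail (a 0) ⬝ᵥ w)) := by
    field_simp
    ring
  rw [h0, mul_pow z, hz, one_mul, add_right_inj] at key
  rw [key]
  refine Finset.sum_congr rfl fun i _ => ?_
  rw [hdot, add_dotProduct, smul_dotProduct, smul_eq_mul, mul_assoc]

/-! ### Membership in the critical Waring variety -/

theorem subset_zariskiClosure {V : Type*} [AddCommGroup V] [Module ℂ V]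
    (S : Set (Projectivization ℂ V)) : S ⊆ zariskiClosure S :=
  fun _ hp _ _ _ hS v hv hvp => hS v hv (hvp ▸ hp)

theorem ne_zero_of_waringRank_eq (hd : d ≠ 0) {r : ℕ} {a : Fin (r + 1) → Fin N → ℂ}
    (hr : waringRank (∑ i, powForm d (linForm (a i))) = r + 1) (i : Fin (r + 1)) : a i ≠ 0 := by
  intro hi
  have : HasWaringDecomposition (∑ i, powForm d (linForm (a i))) r :=
    ⟨fun j => linForm (a (i.succAbove j)), by
      rw [Fin.sum_univ_succAbove _ i, hi, linForm_zero, powForm_zero hd, zero_add]⟩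
  have := waringRank_le this
  omega

theorem mk_mem_openSecant {ι : ℕ} (a : Fin ι → Fin N → ℂ) (ha : ∀ i, a i ≠ 0)
    (hF : ∑ i, powForm d (linForm (a i)) ≠ 0) :
    Projectivization.mk ℂ _ hF ∈ openSecant ι (veronese N d) := by
  refine ⟨fun i => Projectivization.mk ℂ _ (powForm_ne_zero (linForm_ne_zero (ha i))),
    fun i => ⟨_, _, rfl⟩, ?_⟩
  simp only [Projectivization.submodule_mk, Submodule.span_singleton_le_iff_mem]
  exact Submodule.sum_mem _ fun i _ =>
    Submodule.mem_iSup_of_mem i (Submodule.mem_span_singleton_self _)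

theorem mk_mem_waringLocus {r : ℕ} (a : Fin r → Fin N → ℂ) (ha : ∀ i, a i ≠ 0)
    (hr : waringRank (∑ i, powForm d (linForm (a i))) = r) (i : Fin r) :
    Projectivization.mk ℂ _ (linForm_ne_zero (ha i)) ∈
      waringLocus (∑ i, powForm d (linForm (a i))) := by
  change ∃ L : Fin (waringRank (∑ i, powForm d (linForm (a i)))) → Form N 1, _
  rw [hr]
  exact ⟨fun i => linForm (a i), fun i => linForm_ne_zero (ha i), ⟨i, _, rfl⟩,
    Submodule.sum_mem _ fun i _ => Submodule.subset_span ⟨i, rfl⟩⟩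

theorem gradAt_sum_powForm {ι : Type*} [Fintype ι] (a : ι → Fin N → ℂ) (v : Fin N → ℂ)
    (k : Fin N) :
    gradAt (∑ i, powForm d (linForm (a i))) v k = ∑ i, d * (a i ⬝ᵥ v) ^ (d - 1) * a i k := by
  have h : ∀ i, pderiv k (linForm (a i) : MvPolynomial (Fin N) ℂ) = C (a i k) := fun i => by
    simp [linForm, pderiv_X, Pi.single_apply, smul_eq_C_mul]
  simp [gradAt, powForm, Derivation.leibniz_pow, h, eval_linForm, mul_assoc]

/-- A form `x₀ ^ d + L₁ ^ d + ⋯ + Lᵣ ^ d` of rank `r + 1` whose gradient at `e₀` is proportional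
to `e₀` lies in the critical Waring variety. -/
theorem mk_mem_criticalWaringVariety {n r : ℕ} (hd : d ≠ 0) (a : Fin (r + 1) → Fin (n + 1) → ℂ)
    (h0 : a 0 = Pi.single 0 1)
    (hcrit : ∀ k ≠ 0, ∑ i, a i 0 ^ (d - 1) * a i k = 0)
    (hr : waringRank (∑ i, powForm d (linForm (a i))) = r + 1)
    (hF : ∑ i, powForm d (linForm (a i)) ≠ 0) :
    Projectivization.mk ℂ _ hF ∈ criticalWaringVariety n d (r + 1) := by
  have ha := ne_zero_of_waringRank_eq hd hr
  refine subset_zariskiClosure _ ⟨mk_mem_openSecant a ha hF, _, hF, rfl, _,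
    mk_mem_waringLocus a ha hr 0, linForm (a 0), linForm_ne_zero (ha 0), rfl, fun i j => ?_⟩
  have hgrad : ∀ k ≠ 0, gradAt (∑ i, powForm d (linForm (a i))) (a 0) k = 0 := fun k hk => by
    rw [gradAt_sum_powForm, h0]
    simp only [dotProduct_single, mul_one, mul_assoc]
    rw [← Finset.mul_sum, hcrit k hk, mul_zero]
  have ha0 : ∀ k ≠ 0, a 0 k = 0 := fun k hk => by rw [h0, Pi.single_eq_of_ne hk]
  rw [coords_linForm, Matrix.det_fin_two_of]
  by_cases hi : i = 0 <;> by_cases hj : j = 0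
  · rw [hi, hj]; ring
  · rw [hgrad j hj, ha0 j hj]; ring
  · rw [hgrad i hi, ha0 i hi]; ring
  · rw [hgrad j hj, ha0 j hj]; ring

theorem waringRank_zero : waringRank (0 : Form N d) = 0 :=
  Nat.le_zero.1 (waringRank_le ⟨Fin.elim0, by simp⟩)

theorem exists_mem_criticalWaringVariety {n r : ℕ} (hd : d ≠ 0)
    (a : Fin (r + 1) → Fin (n + 1) → ℂ) (h0 : a 0 = Pi.single 0 1)
    (hcrit : ∀ k ≠ 0, ∑ i, a i 0 ^ (d - 1) * a i k = 0)
    (hr : waringRank (∑ i, powForm d (linForm (a i))) = r + 1) :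
    ∃ (F : Form (n + 1) d) (hF : F ≠ 0),
      Projectivization.mk ℂ F hF ∈ criticalWaringVariety n d (r + 1) ∧ waringRank F = r + 1 := by
  have hF : ∑ i, powForm d (linForm (a i)) ≠ 0 := fun h => by
    rw [h, waringRank_zero] at hr
    omega
  exact ⟨_, hF, mk_mem_criticalWaringVariety hd a h0 hcrit hr hF, hr⟩

theorem exists_mem_criticalWaringVariety_of_waringRank {n : ℕ} (hd : 2 ≤ d) (G : Form n d) :
    ∃ (F : Form (n + 1) d) (hF : F ≠ 0),
      Projectivization.mk ℂ F hF ∈ criticalWaringVariety n d (waringRank G + 1) ∧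
        waringRank F = waringRank G + 1 := by
  have hd0 : d ≠ 0 := by omega
  obtain ⟨b, hb⟩ := hasWaringDecomposition_iff_eval.1 (hasWaringDecomposition_waringRank hd0 G)
  set a : Fin (waringRank G + 1) → Fin (n + 1) → ℂ :=
    Fin.cons (Pi.single 0 1) fun i => Fin.cons 0 (b i) with ha
  refine exists_mem_criticalWaringVariety hd0 a rfl (fun k hk => ?_) ?_
  · rw [Fin.sum_univ_succ]
    simp [ha, hk, show d - 1 ≠ 0 by omega]
  · set F := ∑ i, powForm d (linForm (a i)) with hFdef
    have hF : ∀ t w, eval (Fin.cons t w : Fin (n + 1) → ℂ) (F : MvPolynomial (Fin (n + 1)) ℂ) =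
        t ^ d + eval w (G : MvPolynomial (Fin n) ℂ) := fun t w => by
      rw [hFdef, eval_sum_powForm, Fin.sum_univ_succ, hb]
      simp [ha, dotProduct, Fin.sum_univ_succ]
    refine le_antisymm (waringRank_le ⟨_, rfl⟩) ?_
    rcases hs : waringRank F with _ | s
    · have h0 : eval (Fin.cons 1 0 : Fin (n + 1) → ℂ) (F : MvPolynomial (Fin (n + 1)) ℂ) = 0 := by
        obtain ⟨c, hc⟩ :=
          hasWaringDecomposition_iff_eval.1 (hs ▸ hasWaringDecomposition_waringRank hd0 F)
        rw [hc]; simp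
      rw [hF, hb] at h0
      simp [hd0] at h0
    · exact Nat.succ_le_succ (waringRank_le (hasWaringDecomposition_of_add_pow hd hF
        (hs ▸ hasWaringDecomposition_waringRank hd0 F)))

/-! ### Rank of a sum of few powers -/

/-- Apolarity: the coefficients of `(∑ a_k x_k) ^ d` are multinomials times the monomials in `a`.
Hence `∑ g(a_i)` depends only on the form, not on its decomposition. -/
theorem sum_eval_eq {ι : Type*} [Fintype ι] (a : ι → Fin N → ℂ) {g : MvPolynomial (Fin N) ℂ}
    (hg : g.IsHomogeneous d) :
    ∑ i, eval (a i) g = ∑ s ∈ g.support, coeff s g / s.multinomial *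
      coeff s ((∑ i, powForm d (linForm (a i)) : Form N d) : MvPolynomial (Fin N) ℂ) := by
  simp_rw [eval_eq']
  rw [Finset.sum_comm]
  refine Finset.sum_congr rfl fun s hs => ?_
  rw [Submodule.coe_sum, coeff_sum, Finset.mul_sum]
  refine Finset.sum_congr rfl fun i _ => ?_
  have hs' : s.sum (fun _ m => m) = d := (hg.degree_eq_sum_deg_support hs).symm
  have hm : (s.multinomial : ℂ) ≠ 0 := by
    exact_mod_cast (Nat.multinomial_pos _ _).ne'
  change _ = _ * coeff s ((∑ k, a i k • X k) ^ d)
  rw [coeff_linearCombination_X_pow_of_fintype, if_pos hs', Finsupp.prod_fintype _ _ (by simp)]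
  field_simp

theorem exists_dotProduct_separating {p b : Fin N → ℂ} (h : p ∉ Submodule.span ℂ {b}) :
    ∃ c : Fin N → ℂ, c ⬝ᵥ b = 0 ∧ c ⬝ᵥ p ≠ 0 := by
  obtain ⟨f, hf, hb⟩ := Submodule.exists_le_ker_of_notMem h
  have hfv : ∀ v, (fun k => f fun j => if k = j then 1 else 0) ⬝ᵥ v = f v := fun v => by
    rw [LinearMap.pi_apply_eq_sum_univ f v, dotProduct]
    exact Finset.sum_congr rfl fun k _ => mul_comm _ _
  exact ⟨_, (hfv b).trans (hb (Submodule.mem_span_singleton_self b)), by rwa [hfv]⟩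

/-- If `p` is not proportional to any of at most `d` vectors, some form of degree `d` vanishes at
those vectors and not at `p`. -/
theorem exists_isHomogeneous_separating {κ : Type*} [Fintype κ] {p : Fin N → ℂ} (hp : p ≠ 0)
    (b : κ → Fin N → ℂ) (h : ∀ j, p ∉ Submodule.span ℂ {b j}) (hκ : Fintype.card κ ≤ d) :
    ∃ g : MvPolynomial (Fin N) ℂ, g.IsHomogeneous d ∧ (∀ j, eval (b j) g = 0) ∧ eval p g ≠ 0 := by
  choose c hcb hcp using fun j => exists_dotProduct_separating (h j)
  obtain ⟨k, hk⟩ := Function.ne_iff.1 hp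
  -- One hyperplane through each `b j` avoiding `p`, padded to degree `d` by a coordinate nonzero at
  -- `p`.
  refine ⟨(∏ j, (linForm (c j) : MvPolynomial (Fin N) ℂ)) * X k ^ (d - Fintype.card κ),
    ?_, fun j => ?_, ?_⟩
  · have h1 := (IsHomogeneous.prod Finset.univ
      (fun j => (linForm (c j) : MvPolynomial (Fin N) ℂ)) (fun _ => 1)
      fun j _ => (linForm (c j)).2).mul (isHomogeneous_X_pow (R := ℂ) k (d - Fintype.card κ))
    convert h1 using 1
    simp; omega
  · rw [map_mul, map_prod, Finset.prod_eq_zero (Finset.mem_univ j), zero_mul]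
    rw [eval_linForm, hcb]
  · simp only [map_mul, map_prod, eval_linForm, map_pow, eval_X]
    exact mul_ne_zero (Finset.prod_ne_zero_iff.2 fun j _ => hcp j) (pow_ne_zero _ hk)

/-- A sum of the `d`-th powers of `r` pairwise non-proportional linear forms has rank `r` if
`2 * r ≤ d + 1`. -/
theorem waringRank_eq_of_two_mul_le (hd : d ≠ 0) {r : ℕ} (hrd : 2 * r ≤ d + 1)
    (a : Fin r → Fin N → ℂ) (h0 : ∀ i, a i ≠ 0)
    (ha : ∀ i j, a i ∈ Submodule.span ℂ {a j} → i = j) :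
    waringRank (∑ i, powForm d (linForm (a i))) = r := by
  refine le_antisymm (waringRank_le ⟨_, rfl⟩) (not_lt.1 fun hlt => ?_)
  obtain ⟨b, hb⟩ := hasWaringDecomposition_iff.1
    (hasWaringDecomposition_waringRank hd (∑ i, powForm d (linForm (a i))))
  generalize waringRank (∑ i, powForm d (linForm (a i))) = s at hlt b hb
  -- Pigeonhole: two `a i` proportional to the same `b j` would be proportional to each other.
  obtain ⟨i₀, hi₀⟩ : ∃ i, ∀ j, a i ∉ Submodule.span ℂ {b j} := by
    by_contra! hcon
    choose f hf using hcon
    refine absurd (Fintype.card_le_of_injective f fun i j hij => ha i j ?_) (by simpa using hlt)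
    obtain ⟨x, hx⟩ := Submodule.mem_span_singleton.1 (hf i)
    obtain ⟨y, hy⟩ := Submodule.mem_span_singleton.1 (hf j)
    have hy0 : y ≠ 0 := by
      rintro rfl
      exact h0 j (by rw [← hy, zero_smul])
    refine Submodule.mem_span_singleton.2 ⟨x * y⁻¹, ?_⟩
    rw [← hy, ← hx, hij, smul_smul, inv_mul_cancel_right₀ hy0]
  -- There are `(r - 1) + s ≤ 2 * r - 2 ≤ d` vectors to vanish at. Apolarity then equates `g(a i₀) ≠
  -- 0` with `∑ g(b j) = 0`.
  obtain ⟨g, hg, hg0, hgp⟩ := exists_isHomogeneous_separating (d := d) (h0 i₀)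
    (Sum.elim (fun i : {i // i ≠ i₀} => a i) b)
    (by
      rintro (i | j)
      · exact fun h => i.2 (ha _ _ h).symm
      · exact hi₀ j)
    (by simp; omega)
  have := sum_eval_eq a hg
  rw [hb, ← sum_eval_eq b hg, Finset.sum_eq_single_of_mem i₀ (Finset.mem_univ _)
    fun i _ hi => hg0 (Sum.inl ⟨i, hi⟩)] at this
  exact hgp (this.trans (Finset.sum_eq_zero fun j _ => hg0 (Sum.inr j)))

/-! ### Examples from roots of unity -/

theorem exists_mem_criticalWaringVariety_of_two_mul_le {n q : ℕ} (hn : 1 ≤ n) (hq : 2 ≤ q)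
    (hqd : 2 * (q + 1) ≤ d + 1) :
    ∃ (F : Form (n + 1) d) (hF : F ≠ 0),
      Projectivization.mk ℂ F hF ∈ criticalWaringVariety n d (q + 1) ∧ waringRank F = q + 1 := by
  have hd0 : d ≠ 0 := by omega
  obtain ⟨m, rfl⟩ : ∃ m, n = m + 1 := ⟨n - 1, by omega⟩
  have hζ := Complex.isPrimitiveRoot_exp q (by omega)
  set ζ := Complex.exp (2 * Real.pi * Complex.I / q)
  -- The parameter `0` gives `x₀` itself. The `q`-th roots of unity are distinct, nonzero and, since
  -- `q ≥ 2`, sum to zero.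
  set t : Fin (q + 1) → ℂ := Fin.cons 0 fun i => ζ ^ (i : ℕ) with ht
  have htinj : Function.Injective t := by
    refine Fin.cons_injective_iff.2 ⟨?_, fun i j hij => Fin.ext (hζ.pow_inj i.2 j.2 hij)⟩
    rintro ⟨i, hi⟩
    exact pow_ne_zero _ (hζ.ne_zero (by omega)) hi
  set a : Fin (q + 1) → Fin (m + 2) → ℂ := fun i => Pi.single 0 1 + Pi.single 1 (t i) with ha
  have ha0 : ∀ i, a i 0 = 1 := fun i => by simp [ha]
  have ha1 : ∀ i, a i 1 = t i := fun i => by simp [ha]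
  refine exists_mem_criticalWaringVariety hd0 a (by simp [ha, ht]) (fun k hk => ?_)
    (waringRank_eq_of_two_mul_le hd0 hqd a (fun i h => ?_) fun i j h => ?_)
  · simp only [ha0, one_pow, one_mul]
    by_cases hk1 : k = 1
    · subst hk1
      simp only [ha1, ht, Fin.sum_univ_succ, Fin.cons_zero, Fin.cons_succ, zero_add]
      rw [Fin.sum_univ_eq_sum_range (fun i => ζ ^ i) q, hζ.geom_sum_eq_zero (by omega)]
    · exact Finset.sum_eq_zero fun i _ => by simp [ha, hk, hk1]
  · simpa [h] using ha0 i
  · obtain ⟨x, hx⟩ := Submodule.mem_span_singleton.1 h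
    have hx0 := congrFun hx 0
    have hx1 := congrFun hx 1
    simp only [Pi.smul_apply, ha0, ha1, smul_eq_mul, mul_one] at hx0 hx1
    rw [hx0, one_mul] at hx1
    exact (htinj hx1).symm

theorem one_le_maxWaringRank {n : ℕ} (hn : 1 ≤ n) (hd : d ≠ 0) : 1 ≤ maxWaringRank n d := by
  let F : Form n d := powForm d (linForm (Pi.single ⟨0, hn⟩ 1))
  have hF : F ≠ 0 := powForm_ne_zero (linForm_ne_zero (by simp))
  refine le_trans ?_ ((isGreatest_maxWaringRank n hd).2 ⟨F, rfl⟩)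
  by_contra! hlt
  obtain ⟨L, hL⟩ := hasWaringDecomposition_waringRank hd F
  have : IsEmpty (Fin (waringRank F)) := by
    rw [Nat.lt_one_iff.1 hlt]; infer_instance
  exact hF (by rw [hL]; simp)

end Waring

theorem mainTheorem10 (n d : ℕ) (hn : 1 ≤ n) (hd : 2 ≤ d) :
    IsGreatest (Set.range fun G : Waring.Form n d => Waring.waringRank G)
      (Waring.maxWaringRank n d) ∧
    ∀ r : ℕ, 1 ≤ r →
      (r : ℝ) ≤ max (((d : ℝ) + 1) / 2) ((Waring.maxWaringRank n d : ℝ) + 1) →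
      ∃ (F : Waring.Form (n + 1) d) (hF : F ≠ 0),
        Projectivization.mk ℂ F hF ∈ Waring.criticalWaringVariety n d r ∧
        Waring.waringRank F = r := by
  have hd0 : d ≠ 0 := by omega
  have hmax := Waring.isGreatest_maxWaringRank n hd0
  refine ⟨hmax, fun r hr hle => ?_⟩
  obtain ⟨q, rfl⟩ : ∃ q, r = q + 1 := ⟨r - 1, by omega⟩
  by_cases hq : q ≤ Waring.maxWaringRank n d
  · obtain ⟨G, hG⟩ := hmax.1
    obtain ⟨H, rfl⟩ := Waring.exists_waringRank_eq_of_le hd0 G (hq.trans hG.ge)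
    exact Waring.exists_mem_criticalWaringVariety_of_waringRank hd H
  -- Here `q > m_{n-1} ≥ 1`, which gives the `q ≥ 2` needed by the roots of unity.
  · have h1 := Waring.one_le_maxWaringRank hn hd0
    refine Waring.exists_mem_criticalWaringVariety_of_two_mul_le hn (by omega) ?_
    rcases le_max_iff.1 hle with h | h
    · rw [le_div_iff₀ two_pos] at h
      have : (q + 1) * 2 ≤ d + 1 := by exact_mod_cast h
      omega
    · have : q + 1 ≤ Waring.maxWaringRank n d + 1 := by exact_mod_cast h
      omega
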